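/- Let $1\le M\le N$ be integers, let $a=(a_1,\dots,a_M)$ and $b=(b_0,b_1,\dots,b_N)$ be positive real numbers, and let $1\le i\le M$. For $m\ge 0$, $c=(c_1,\dots,c_m)\in(0,\infty)^m$ and $\Re(w)>0$, let $s\mapsto\zeta_m(s,w\,|\,c)$ be the analytic continuation to $\mathbb{C}\setminus\{1,\dots,m\}$ (which exists and is unique) of $$\frac{1}{\Gamma(s)}\int_0^\infty t^{s-1}e^{-wt}\prod_{j=1}^m(1-e^{-c_jt})^{-1}\,dt,\qquad \Re(s)>m,$$ and let $L_m(w\,|\,c)=\partial_s\zeta_m(s,w\,|\,c)|_{s=0}$ be the Barnes multiple log-gamma function. For a function $f$ put $$(\mathcal{S}_Nf)(q\,|\,b)=\sum_{p=0}^N(-1)^p\sum_{1\le k_1<\cdots<k_p\le N}f(q+b_0+b_{k_1}+\cdots+b_{k_p}).$$ For $\Re(q)>-b_0$ define $$\eta_{M,N}(q\,|\,a,b)=\exp\Bigl(\bigl(\mathcal{S}_NL_M(\cdot\,|\,a)\bigr)(q\,|\,b)-\bigl(\mathcal{S}_NL_M(\cdot\,|\,a)\bigr)(0\,|\,b)\Bigr),$$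 and, with $\hat a_i=(a_1,\dots,a_{i-1},a_{i+1},\dots,a_M)$, define the power series $$\mathcal{L}^{(i)}_{M,N}(x\,|\,a,b)=\sum_{k=0}^\infty\frac{(-x)^k}{k!}\exp\Bigl(-\sum_{l=0}^{k-1}\bigl(\mathcal{S}_NL_{M-1}(\cdot\,|\,\hat a_i)\bigr)(l a_i\,|\,b)\Bigr).$$ Then this power series converges absolutely for every $x\in\mathbb{C}$, and for every $q\in\mathbb{C}$ with $0<\Re(q)<b_0/a_i$ the following integral converges absolutely and $$\int_0^\infty x^{q-1}\,\mathcal{L}^{(i)}_{M,N}(x\,|\,a,b)\,dx=\Gamma(q)\,\eta_{M,N}(-q\,a_i\,|\,a,b).$$ -/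

import Mathlib

namespace BarnesBeta

noncomputable section

/-- The generalized zeta integral
`(1 / Γ(s)) ∫₀^∞ t^(s-1) e^(-wt) f(t) dt / t^M`, where `f(t) = t^M ∏ⱼ (1 - e^(-aⱼ t))⁻¹`,
so that `f(t) / t^M = ∏ⱼ (1 - e^(-aⱼ t))⁻¹`. It converges for `Re s > M` and `Re w > 0`. -/
def zetaIntegral {M : ℕ} (a : Fin M → ℝ) (w s : ℂ) : ℂ :=
  (1 / Complex.Gamma s) *
    ∫ t in Set.Ioi (0 : ℝ), (t : ℂ) ^ (s - 1) * Complex.exp (-w * t) *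
      ∏ j : Fin M, (1 - Complex.exp (-(a j : ℂ) * t))⁻¹

/-- The complement in `ℂ` of the possible poles `1, …, M`. -/
def zetaDomain (M : ℕ) : Set ℂ := ((fun k : ℕ => (k : ℂ)) '' Set.Icc 1 M)ᶜ

/-- `Z` is the analytic continuation in `s` of the zeta integral to `ℂ ∖ {1, …, M}`. -/
def IsZetaContinuation {M : ℕ} (a : Fin M → ℝ) (w : ℂ) (Z : ℂ → ℂ) : Prop :=
  DifferentiableOn ℂ Z (zetaDomain M) ∧ ∀ s : ℂ, (M : ℝ) < s.re → Z s = zetaIntegral a w s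

/-- The continuation is unique on `ℂ ∖ {1, …, M}`. -/
theorem IsZetaContinuation.eqOn {M : ℕ} {a : Fin M → ℝ} {w : ℂ} {Z₁ Z₂ : ℂ → ℂ}
    (h₁ : IsZetaContinuation a w Z₁) (h₂ : IsZetaContinuation a w Z₂) :
    Set.EqOn Z₁ Z₂ (zetaDomain M) := by
  have hfin : ((fun k : ℕ => (k : ℂ)) '' Set.Icc 1 M).Finite := (Set.finite_Icc 1 M).image _
  have hopen : IsOpen (zetaDomain M) := hfin.isClosed.isOpen_compl
  have hconn : IsPreconnected (zetaDomain M) :=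
    (hfin.countable.isConnected_compl_of_one_lt_rank (by simp)).isPreconnected
  have hmem : ((M : ℂ) + 1) ∈ zetaDomain M := by
    rintro ⟨k, hk, hk'⟩
    have : (k : ℂ) = ((M + 1 : ℕ) : ℂ) := by simpa using hk'
    have := Nat.cast_injective this
    have := hk.2
    omega
  refine (h₁.1.analyticOnNhd hopen).eqOn_of_preconnected_of_eventuallyEq
    (h₂.1.analyticOnNhd hopen) hconn hmem ?_
  have hU : {s : ℂ | (M : ℝ) < s.re} ∈ nhds ((M : ℂ) + 1) :=
    (isOpen_lt continuous_const Complex.continuous_re).mem_nhds (by simp)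
  filter_upwards [hU] with s hs
  rw [h₁.2 s hs, h₂.2 s hs]

/-- The Barnes multiple zeta function `ζ_M(s, w | a)`, `Re w > 0`: the analytic continuation
in `s` of the zeta integral. -/
def barnesZeta {M : ℕ} (a : Fin M → ℝ) (w : ℂ) : ℂ → ℂ :=
  Classical.epsilon (IsZetaContinuation a w)

/-- The Barnes multiple log-gamma function `L_M(w | a) = ∂ₛ ζ_M(s, w | a)` at `s = 0`,
`Re w > 0`. -/
def logGamma {M : ℕ} (a : Fin M → ℝ) (w : ℂ) : ℂ :=
  deriv (barnesZeta a w) 0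

/-- The operator `(S_N f)(q | b) = ∑ₚ (-1)^p ∑_{k₁ < ⋯ < kₚ} f(q + b₀ + b_{k₁} + ⋯ + b_{kₚ})`,
with indices `kᵢ` in `{1, …, N}`. -/
def opS {N : ℕ} (f : ℂ → ℂ) (q : ℂ) (b : Fin (N + 1) → ℝ) : ℂ :=
  ∑ p ∈ Finset.range (N + 1), (-1 : ℂ) ^ p *
    ∑ K ∈ Finset.powersetCard p (Finset.univ : Finset (Fin N)),
      f (q + (b 0 : ℂ) + ∑ k ∈ K, (b k.succ : ℂ))

/-- `η_{M,N}(q | a, b) = exp((S_N L_M)(q | b) - (S_N L_M)(0 | b))`, `Re q > -b₀`. -/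
def eta {M N : ℕ} (a : Fin M → ℝ) (b : Fin (N + 1) → ℝ) (q : ℂ) : ℂ :=
  Complex.exp (opS (logGamma a) q b - opS (logGamma a) 0 b)

/-- The `k`-th term of the power series `𝓛^{(i)}_{M+1,N}(x | a, b)`; here `i.removeNth a` is
the tuple `a` with its `i`-th entry deleted. -/
def laplaceTerm {M N : ℕ} (a : Fin (M + 1) → ℝ) (b : Fin (N + 1) → ℝ) (i : Fin (M + 1))
    (x : ℂ) (k : ℕ) : ℂ :=
  (-x) ^ k / (k.factorial : ℂ) *
    Complex.exp (-∑ l ∈ Finset.range k, opS (logGamma (i.removeNth a)) ((l : ℂ) * (a i : ℂ)) b)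

/-- The Laplace transform power series `𝓛^{(i)}_{M+1,N}(x | a, b)`. -/
def laplaceSeries {M N : ℕ} (a : Fin (M + 1) → ℝ) (b : Fin (N + 1) → ℝ) (i : Fin (M + 1))
    (x : ℂ) : ℂ :=
  ∑' k : ℕ, laplaceTerm a b i x k

end

end BarnesBeta

/-! The function `eta` is the Laplace transform of an infinitely divisible law on the half-line:
`eta a b z` is the exponential of the integral of `(e^{-zt} - 1) levyRatio(t) dt/t` over `t > 0`,
and `levyRatio` is nonnegative because `a` and `b` are positive (`opS_logGamma_sub_eq`). Writing α
for `a i`, the same integral formula and a geometric sum show that the exponential coefficient in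
the `k`-th series term is `eta a b (k α)` (`neg_sum_opS_logGamma_removeNth`).

If `T ≥ 0` has this law, the series is therefore the expansion of `E exp(-x e^{-αT})`. Fubini and
the Gamma integral give its Mellin transform `Γ(q) E e^{qαT} = Γ(q) eta(-qα)`, and the exponential
moment is finite for `Re q < b₀/α`. This is Ramanujan's master formula for a completely monotone
function.

The law of `T` itself is never built. `exists_tendsto_laplaceTransform` supplies probability
measures whose Laplace transforms tend to `eta` on `Re z > -b₀`, and
`mellin_tsum_of_tendsto_laplaceTransform` passes to the limit in the formula by dominated
convergence.

The integral formula for `eta` needs the continued zeta function at `s = 0`. The continuation comes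
from subtracting expansion terms at `t = 0`; in suitable combinations the integrand vanishes at `0`,
and then the derivative at `s = 0` is a convergent integral (`sum_mul_logGamma`). -/

namespace BarnesBeta

open Complex MeasureTheory Set Filter Topology Asymptotics

/-! ### Continuation of Mellin transforms divided by Gamma. -/

/-- The rational function equal to `Γ(s + n - m) / Γ(s)`. -/
noncomputable def gammaQuot (m n : ℕ) (s : ℂ) : ℂ :=
  (∏ j ∈ Finset.range n, (s - m + j)) / ∏ j ∈ Finset.range m, (s - m + j)

theorem inv_Gamma_eq_prod_mul (s : ℂ) (n : ℕ) :
    (Gamma s)⁻¹ = (∏ j ∈ Finset.range n, (s + j)) * (Gamma (s + n))⁻¹ := by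
  induction n with
  | zero => simp
  | succ n ih =>
    rw [ih, Finset.prod_range_succ, one_div_Gamma_eq_self_mul_one_div_Gamma_add_one (s + n)]
    push_cast
    rw [add_assoc s]
    ring

theorem gammaQuot_denom_ne_zero {m : ℕ} {s : ℂ} (hs : s ∈ zetaDomain m) :
    ∏ j ∈ Finset.range m, (s - m + j) ≠ 0 := by
  rw [Finset.prod_ne_zero_iff]
  intro j hj h0
  have hj' := Finset.mem_range.1 hj
  refine hs ⟨m - j, ⟨by omega, by omega⟩, ?_⟩
  simp only [Nat.cast_sub hj'.le]
  linear_combination -h0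

/-- Both `1/Γ(s)` and `1/Γ(s - m + n)` are reached from `1/Γ(s - m)` by the reciprocal recurrence,
which holds at the poles too; the bound on `Re s` keeps `Γ(s - m + n)` nonzero. -/
theorem gammaQuot_eq {m n : ℕ} {s : ℂ} (hs : s ∈ zetaDomain m) (h : (m : ℝ) - n < s.re) :
    (Gamma s)⁻¹ * Gamma (s + ((n : ℂ) - m)) = gammaQuot m n s := by
  have h1 := inv_Gamma_eq_prod_mul (s - m) m
  have h2 := inv_Gamma_eq_prod_mul (s - m) n
  have hne : Gamma (s - m + n) ≠ 0 := Gamma_ne_zero_of_re_pos (by simp; linarith)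
  have hd := gammaQuot_denom_ne_zero hs
  rw [show s + ((n : ℂ) - m) = s - m + n by ring, gammaQuot, eq_div_iff hd]
  rw [h1, sub_add_cancel] at h2
  field_simp at h2 ⊢
  calc _ = (∏ j ∈ Finset.range m, (s - m + j)) * Gamma (s - m + n) / Gamma s := by ring
    _ = _ := h2

theorem isOpen_zetaDomain (m : ℕ) : IsOpen (zetaDomain m) :=
  ((Set.finite_Icc 1 m).image _).isClosed.isOpen_compl

theorem mem_zetaDomain_of_lt_re {m : ℕ} {s : ℂ} (hs : (m : ℝ) < s.re) : s ∈ zetaDomain m := by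
  rintro ⟨k, hk, rfl⟩
  rw [natCast_re, Nat.cast_lt] at hs
  exact absurd hk.2 (not_le.2 hs)

theorem differentiableAt_gammaQuot {m n : ℕ} {s : ℂ} (hs : s ∈ zetaDomain m) :
    DifferentiableAt ℂ (gammaQuot m n) s := by
  unfold gammaQuot
  exact DifferentiableAt.div (by fun_prop) (by fun_prop) (gammaQuot_denom_ne_zero hs)

theorem hasMellin_cpow_mul_exp_neg {s α : ℂ} (h : 0 < (s + α).re) :
    HasMellin (fun t : ℝ => (t : ℂ) ^ α * exp (-t)) s (Gamma (s + α)) := by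
  have h1 : MellinConvergent (fun t : ℝ => exp (-t)) (s + α) := by
    have := GammaIntegral_convergent h
    refine this.congr_fun (fun t _ => ?_) measurableSet_Ioi
    simp [mul_comm]
  refine ⟨(MellinConvergent.cpow_smul (f := fun t : ℝ => exp (-t))).2 h1, ?_⟩
  rw [Gamma_eq_integral h, GammaIntegral_eq_mellin]
  have := mellin_cpow_smul (fun t : ℝ => exp (-t)) s α
  simp only [smul_eq_mul] at this
  rw [this]
  simp

/-- Removing from `f` the leading terms of its expansion at `0`. -/
noncomputable def expansionRemainder (f : ℝ → ℂ) (c : ℕ → ℂ) (m K : ℕ) (t : ℝ) : ℂ :=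
  f t - ∑ n ∈ Finset.range K, c n * ((t : ℂ) ^ ((n : ℂ) - m) * exp (-t))

/-- The continuation of `Γ(s)⁻¹` times the Mellin transform to `Re s > m - K`. -/
noncomputable def mellinStep (f : ℝ → ℂ) (c : ℕ → ℂ) (m K : ℕ) (s : ℂ) : ℂ :=
  ∑ n ∈ Finset.range K, c n * gammaQuot m n s +
    (Gamma s)⁻¹ * mellin (expansionRemainder f c m K) s

section Continuation

variable {f : ℝ → ℂ} {c : ℕ → ℂ} {m : ℕ} {δ : ℝ}

theorem continuousOn_expansionRemainder (hf : ContinuousOn f (Ioi 0)) (K : ℕ) :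
    ContinuousOn (expansionRemainder f c m K) (Ioi 0) := by
  refine hf.sub (continuousOn_finsetSum _ fun n _ => continuousOn_const.mul
    (ContinuousOn.mul (fun t ht => ?_) (by fun_prop)))
  exact (continuousAt_ofReal_cpow_const t _ (Or.inr (ne_of_gt ht))).continuousWithinAt

theorem isBigO_cpow_mul_exp_neg (α : ℂ) (hδ : δ < 1) :
    (fun t : ℝ => (t : ℂ) ^ α * exp (-t)) =O[atTop] fun t => Real.exp (-δ * t) := by
  have h := (isLittleO_rpow_exp_pos_mul_atTop α.re (sub_pos.2 hδ)).isBigO.mul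
    (isBigO_refl (fun t : ℝ => Real.exp (-t)) atTop)
  refine (IsBigO.congr' (h.norm_left) ?_ ?_ : (fun t : ℝ => ‖(t : ℂ) ^ α * exp (-t)‖) =O[atTop]
    fun t => Real.exp (-δ * t)).of_norm_left
  · filter_upwards [eventually_gt_atTop 0] with t ht
    rw [norm_mul, norm_mul, norm_cpow_eq_rpow_re_of_pos ht, norm_exp]
    simp [abs_of_pos (Real.rpow_pos_of_pos ht _)]
  · refine Eventually.of_forall fun t => ?_
    beta_reduce
    rw [← Real.exp_add]
    ring_nf

theorem isBigO_expansionRemainder (hδ : δ < 1)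
    (hf : f =O[atTop] fun t => Real.exp (-δ * t)) (K : ℕ) :
    expansionRemainder f c m K =O[atTop] fun t => Real.exp (-δ * t) :=
  hf.sub (IsBigO.fun_sum fun _ _ => (isBigO_cpow_mul_exp_neg _ hδ).const_mul_left _)

variable (hfc : ContinuousOn f (Ioi 0)) (hδ0 : 0 < δ) (hδ : δ < 1)
    (hf : f =O[atTop] fun t => Real.exp (-δ * t))
    (hc : ∀ K : ℕ, expansionRemainder f c m K =O[𝓝[>] 0] fun t : ℝ => t ^ (-((m : ℝ) - K)))

include hfc hδ0 hδ hf hc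

theorem mellinConvergent_expansionRemainder {K : ℕ} {s : ℂ} (hs : (m : ℝ) - K < s.re) :
    MellinConvergent (expansionRemainder f c m K) s :=
  mellinConvergent_of_isBigO_rpow_exp hδ0
    ((continuousOn_expansionRemainder hfc K).locallyIntegrableOn measurableSet_Ioi)
    (isBigO_expansionRemainder hδ hf K) (hc K) hs

theorem differentiableAt_mellinStep {K : ℕ} {s : ℂ} (hs : (m : ℝ) - K < s.re)
    (hs' : s ∈ zetaDomain m) : DifferentiableAt ℂ (mellinStep f c m K) s := by
  refine DifferentiableAt.add (DifferentiableAt.fun_sum fun n _ =>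
    (differentiableAt_gammaQuot hs').const_mul _)
    ((differentiable_one_div_Gamma s).mul ?_)
  exact mellin_differentiableAt_of_isBigO_rpow_exp hδ0
    ((continuousOn_expansionRemainder hfc K).locallyIntegrableOn measurableSet_Ioi)
    (isBigO_expansionRemainder hδ hf K) (hc K) hs

/-- The term moved out of the remainder has Mellin transform `c K * Γ(s + K - m)`, convergent
exactly in the half-plane assumed; divided by `Γ(s)` it is the added rational term. -/
theorem mellinStep_succ {K : ℕ} {s : ℂ} (hs : (m : ℝ) - K < s.re) (hs' : s ∈ zetaDomain m) :
    mellinStep f c m (K + 1) s = mellinStep f c m K s := by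
  have h0 : 0 < (s + ((K : ℂ) - m)).re := by simp; linarith
  have h1 := mellinConvergent_expansionRemainder hfc hδ0 hδ hf hc hs
  have h2 := hasMellin_cpow_mul_exp_neg h0
  have h3 := hasMellin_const_smul h2.1 (c K)
  have h4 := hasMellin_sub h1 h3.1
  have h5 : expansionRemainder f c m (K + 1) = fun t => expansionRemainder f c m K t -
      c K • ((t : ℂ) ^ ((K : ℂ) - m) * exp (-t)) := by
    funext t
    simp only [expansionRemainder, Finset.sum_range_succ, smul_eq_mul]
    ring
  rw [mellinStep, mellinStep, h5, h4.2, h3.2, h2.2, Finset.sum_range_succ, ← gammaQuot_eq hs' hs,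
    smul_eq_mul]
  ring

theorem mellinStep_add {K : ℕ} {s : ℂ} (hs : (m : ℝ) - K < s.re) (hs' : s ∈ zetaDomain m)
    (l : ℕ) : mellinStep f c m (K + l) s = mellinStep f c m K s := by
  induction l with
  | zero => rfl
  | succ l ih =>
    rw [← add_assoc, mellinStep_succ hfc hδ0 hδ hf hc _ hs', ih]
    push_cast
    linarith [l.cast_nonneg (α := ℝ)]

theorem mellinStep_eq {K K' : ℕ} {s : ℂ} (hs : (m : ℝ) - K < s.re) (hK' : (m : ℝ) - K' < s.re)
    (hs' : s ∈ zetaDomain m) : mellinStep f c m K s = mellinStep f c m K' s := by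
  rcases le_total K K' with h | h
  · obtain ⟨l, rfl⟩ := Nat.exists_eq_add_of_le h
    exact (mellinStep_add hfc hδ0 hδ hf hc hs hs' l).symm
  · obtain ⟨l, rfl⟩ := Nat.exists_eq_add_of_le h
    exact mellinStep_add hfc hδ0 hδ hf hc hK' hs' l

theorem exists_mellin_continuation : ∃ Z : ℂ → ℂ, DifferentiableOn ℂ Z (zetaDomain m) ∧
    ∀ s : ℂ, (m : ℝ) < s.re → Z s = (Gamma s)⁻¹ * mellin f s := by
  -- The order is chosen pointwise; near each `s` the value agrees with that of the fixed order `κ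
  -- s`, which gives differentiability.
  let κ : ℂ → ℕ := fun s => ⌈(m : ℝ) - s.re⌉₊ + 1
  have hκ : ∀ s : ℂ, (m : ℝ) - κ s < s.re := fun s => by
    have := Nat.le_ceil ((m : ℝ) - s.re)
    simp only [κ]
    push_cast
    linarith
  refine ⟨fun s => mellinStep f c m (κ s) s, fun s hs => ?_, fun s hs => ?_⟩
  · refine ((differentiableAt_mellinStep hfc hδ0 hδ hf hc (hκ s) hs).congr_of_eventuallyEq
      ?_).differentiableWithinAt
    have hU : {z : ℂ | (m : ℝ) - κ s < z.re} ∈ 𝓝 s :=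
      (isOpen_lt continuous_const continuous_re).mem_nhds (hκ s)
    filter_upwards [hU, (isOpen_zetaDomain m).mem_nhds hs] with z hz hz'
    exact mellinStep_eq hfc hδ0 hδ hf hc (hκ z) hz hz'
  · change mellinStep f c m (κ s) s = _
    rw [mellinStep_eq hfc hδ0 hδ hf hc (hκ s) (K' := 0) (by simpa using hs)
      (mem_zetaDomain_of_lt_re hs), mellinStep, Finset.sum_range_zero, zero_add]
    congr 2
    funext t
    simp [expansionRemainder]

end Continuation

/-! ### The Barnes integrand: decay at infinity and expansion at zero. -/

/-- The integrand of the Barnes zeta integral, without the Mellin kernel. -/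
noncomputable def barnesIntegrand {m : ℕ} (a : Fin m → ℝ) (w : ℂ) (t : ℝ) : ℂ :=
  exp (-w * t) * ∏ j : Fin m, (1 - exp (-(a j : ℂ) * t))⁻¹

theorem zetaIntegral_eq_mellin {m : ℕ} (a : Fin m → ℝ) (w s : ℂ) :
    zetaIntegral a w s = (Gamma s)⁻¹ * mellin (barnesIntegrand a w) s := by
  simp only [zetaIntegral, one_div, mellin, barnesIntegrand, smul_eq_mul, mul_assoc]

theorem one_sub_cexp_ofReal (a t : ℝ) :
    1 - exp (-(a : ℂ) * t) = ((1 - Real.exp (-a * t) : ℝ) : ℂ) := by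
  push_cast
  rfl

theorem one_sub_exp_pos {a t : ℝ} (ha : 0 < a) (ht : 0 < t) : 0 < 1 - Real.exp (-a * t) := by
  rw [sub_pos, Real.exp_lt_one_iff]
  nlinarith [mul_pos ha ht]

theorem one_sub_cexp_ne_zero {a t : ℝ} (ha : 0 < a) (ht : 0 < t) :
    1 - exp (-(a : ℂ) * t) ≠ 0 := by
  rw [one_sub_cexp_ofReal]
  exact ofReal_ne_zero.2 (one_sub_exp_pos ha ht).ne'

section

variable {m : ℕ} {a : Fin m → ℝ} (ha : ∀ j, 0 < a j)

include ha

theorem continuousOn_barnesIntegrand (w : ℂ) : ContinuousOn (barnesIntegrand a w) (Ioi 0) := by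
  refine ContinuousOn.mul (by fun_prop) (continuousOn_finsetProd _ fun j _ => ?_)
  exact ContinuousOn.inv₀ (by fun_prop) fun t ht => one_sub_cexp_ne_zero (ha j) ht

theorem isBigO_barnesIntegrand_atTop {w : ℂ} {δ : ℝ} (hδ : δ ≤ w.re) :
    barnesIntegrand a w =O[atTop] fun t => Real.exp (-δ * t) := by
  have h1 : (fun t : ℝ => exp (-w * t)) =O[atTop] fun t => Real.exp (-δ * t) := by
    refine IsBigO.of_bound 1 ?_
    filter_upwards [eventually_ge_atTop 0] with t ht
    rw [norm_exp, one_mul, Real.norm_of_nonneg (Real.exp_pos _).le, Real.exp_le_exp]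
    simp only [neg_mul, neg_re, re_mul_ofReal]
    nlinarith
  have h2 : (fun t : ℝ => ∏ j : Fin m, (1 - exp (-(a j : ℂ) * t))⁻¹) =O[atTop]
      fun _ => (1 : ℝ) := by
    have : Tendsto (fun t : ℝ => ∏ j : Fin m, (1 - exp (-(a j : ℂ) * t))⁻¹) atTop
        (𝓝 (∏ j : Fin m, (1 - ((0 : ℝ) : ℂ))⁻¹)) := by
      refine tendsto_finsetProd _ fun j _ => ?_
      refine Tendsto.inv₀ ?_ (by simp)
      refine tendsto_const_nhds.sub ?_
      have : Tendsto (fun t : ℝ => ((Real.exp (-a j * t) : ℝ) : ℂ)) atTop (𝓝 ((0 : ℝ) : ℂ)) := by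
        refine (continuous_ofReal.tendsto 0).comp (Real.tendsto_exp_atBot.comp ?_)
        exact tendsto_id.const_mul_atTop_of_neg (neg_lt_zero.2 (ha j))
      refine this.congr fun t => ?_
      push_cast
      rfl
    exact this.isBigO_one ℝ
  exact (h1.mul h2).congr_right fun t => mul_one _

/-- Each `1 - e^{-a_j z}` is `z` times its difference quotient at `0`, which is analytic with value
`a_j ≠ 0` there. The factor `e^{-t}` is split off so that the expansion terms have the decaying form
used in `expansionRemainder`. -/
theorem exists_barnesIntegrand_eq (w : ℂ) : ∃ G : ℂ → ℂ, AnalyticAt ℂ G 0 ∧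
    ∀ t : ℝ, 0 < t → barnesIntegrand a w t = (t : ℂ) ^ (-(m : ℂ)) * exp (-t) * G t := by
  let g : ℝ → ℂ → ℂ := fun r z => 1 - exp (-(r : ℂ) * z)
  have hg : ∀ r z, HasDerivAt (g r) (r * exp (-(r : ℂ) * z)) z := fun r z => by
    have := ((hasDerivAt_id z).const_mul (-(r : ℂ))).cexp.const_sub 1
    refine this.congr_deriv ?_
    simp only [id]
    ring
  refine ⟨fun z => exp ((1 - w) * z) * ∏ j, (dslope (g (a j)) 0 z)⁻¹, ?_, fun t ht => ?_⟩
  · refine AnalyticAt.mul (by fun_prop) (Finset.analyticAt_fun_prod _ fun j _ => ?_)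
    refine AnalyticAt.inv ?_ ?_
    · have : AnalyticAt ℂ (g (a j)) 0 := by
        simp only [g]
        fun_prop
      obtain ⟨p, hp⟩ := this
      exact ⟨_, hp.has_fpower_series_dslope_fslope⟩
    · rw [dslope_same, (hg _ _).deriv]
      simp [(ha j).ne']
  · have ht' : (t : ℂ) ≠ 0 := ofReal_ne_zero.2 ht.ne'
    have h1 : ∀ j, (dslope (g (a j)) 0 t)⁻¹ = t * (1 - exp (-(a j : ℂ) * t))⁻¹ := fun j => by
      rw [dslope_of_ne _ ht', slope_def_field]
      simp [g]
      field_simp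
    simp only [h1, Finset.prod_mul_distrib, Finset.prod_const, Finset.card_univ, Fintype.card_fin,
      barnesIntegrand, cpow_neg, cpow_natCast]
    have h2 : exp (-w * t) = exp (-t) * exp ((1 - w) * t) := by
      rw [← exp_add]
      ring_nf
    rw [h2]
    field_simp

theorem exists_expansionRemainder_barnesIntegrand (w : ℂ) : ∃ c : ℕ → ℂ, ∀ K : ℕ,
    expansionRemainder (barnesIntegrand a w) c m K =O[𝓝[>] 0]
      fun t : ℝ => t ^ (-((m : ℝ) - K)) := by
  obtain ⟨G, ⟨p, hp⟩, hG⟩ := exists_barnesIntegrand_eq ha w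
  refine ⟨p.coeff, fun K => ?_⟩
  have h1 := (hp.isBigO_sub_partialSum_pow K).comp_tendsto
    (k := fun t : ℝ => (t : ℂ)) (l' := 𝓝[>] 0)
    ((continuous_ofReal.tendsto' 0 0 ofReal_zero).mono_left nhdsWithin_le_nhds)
  have h2 : (fun t : ℝ => (t : ℂ) ^ (-(m : ℂ)) * exp (-t)) =O[𝓝[>] 0]
      fun t : ℝ => t ^ (-(m : ℝ)) := by
    refine IsBigO.of_bound 1 ?_
    filter_upwards [self_mem_nhdsWithin] with t ht
    have ht : 0 < t := ht
    rw [norm_mul, norm_cpow_eq_rpow_re_of_pos ht, norm_exp, one_mul,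
      Real.norm_of_nonneg (Real.rpow_nonneg ht.le _)]
    refine mul_le_of_le_one_right (Real.rpow_nonneg ht.le _) ?_
    simpa using ht.le
  refine (h2.mul h1).congr' ?_ ?_
  · filter_upwards [self_mem_nhdsWithin] with t ht
    have ht : 0 < t := ht
    have ht' : (t : ℂ) ≠ 0 := ofReal_ne_zero.2 ht.ne'
    simp only [Function.comp, zero_add, FormalMultilinearSeries.partialSum,
      FormalMultilinearSeries.apply_eq_pow_smul_coeff, expansionRemainder, hG t ht, smul_eq_mul,
      mul_sub, Finset.mul_sum]
    congr 1
    refine Finset.sum_congr rfl fun n _ => ?_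
    rw [show (n : ℂ) - m = -(m : ℂ) + n by ring, cpow_add _ _ ht', cpow_natCast]
    ring
  · filter_upwards [self_mem_nhdsWithin] with t ht
    have ht : 0 < t := ht
    simp only [Function.comp, norm_real, Real.norm_of_nonneg ht.le]
    rw [show -((m : ℝ) - K) = -(m : ℝ) + K by ring, Real.rpow_add ht, Real.rpow_natCast]

theorem isZetaContinuation_barnesZeta {w : ℂ} (hw : 0 < w.re) :
    IsZetaContinuation a w (barnesZeta a w) := by
  have hex : ∃ Z, IsZetaContinuation a w Z := by
    obtain ⟨c, hc⟩ := exists_expansionRemainder_barnesIntegrand ha w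
    -- The rate must not exceed `Re w`, and must be below `1` so that the subtracted terms `t^{n-m}
    -- e^{-t}` also decay at that rate.
    obtain ⟨Z, h1, h2⟩ := exists_mellin_continuation (δ := min w.re (1 / 2))
      (continuousOn_barnesIntegrand ha w) (lt_min hw (by norm_num))
      ((min_le_right _ _).trans_lt (by norm_num))
      (isBigO_barnesIntegrand_atTop ha (min_le_left _ _)) hc
    exact ⟨Z, h1, fun s hs => by rw [h2 s hs, zetaIntegral_eq_mellin]⟩
  exact Classical.epsilon_spec hex

theorem mellinConvergent_barnesIntegrand {w s : ℂ} (hw : 0 < w.re) (hs : (m : ℝ) < s.re) :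
    MellinConvergent (barnesIntegrand a w) s := by
  obtain ⟨c, hc⟩ := exists_expansionRemainder_barnesIntegrand ha w
  have h0 := hc 0
  have : expansionRemainder (barnesIntegrand a w) c m 0 = barnesIntegrand a w := by
    funext t
    simp [expansionRemainder]
  rw [this] at h0
  exact mellinConvergent_of_isBigO_rpow_exp hw
    ((continuousOn_barnesIntegrand ha w).locallyIntegrableOn measurableSet_Ioi)
    (isBigO_barnesIntegrand_atTop ha le_rfl) h0 (by simpa using hs)

end

/-! ### Log-gamma combinations as integrals against `dt/t`. -/

theorem isPreconnected_halfPlane_inter_zetaDomain (m : ℕ) (r : ℝ) :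
    IsPreconnected ({s : ℂ | r < s.re} ∩ zetaDomain m) := by
  -- This map carries the plane bijectively onto the half-plane, which reduces the claim to the
  -- complement of a finite set in the plane.
  let φ : ℂ → ℂ := fun z => ⟨r + Real.exp z.re, z.im⟩
  have hφ : Continuous φ := by
    have : φ = fun z => ((r + Real.exp z.re : ℝ) : ℂ) + (z.im : ℂ) * I := by
      funext z
      exact (mk_eq_add_mul_I _ _)
    rw [this]
    fun_prop
  have hinj : Function.Injective φ := fun z z' h => by
    have h1 := congrArg Complex.re h
    have h2 := congrArg Complex.im h
    simp only [φ, add_right_inj, Real.exp_eq_exp] at h1 h2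
    exact Complex.ext h1 h2
  have hfin : ((fun k : ℕ => (k : ℂ)) '' Set.Icc 1 m).Finite := (Set.finite_Icc 1 m).image _
  have himg : {s : ℂ | r < s.re} ∩ zetaDomain m =
      φ '' (φ ⁻¹' ((fun k : ℕ => (k : ℂ)) '' Set.Icc 1 m))ᶜ := by
    ext s
    constructor
    · rintro ⟨h1, h2⟩
      have h1 : r < s.re := h1
      have : φ ⟨Real.log (s.re - r), s.im⟩ = s := by
        simp [φ, Real.exp_log (sub_pos.2 h1)]
      exact ⟨_, by rwa [mem_compl_iff, mem_preimage, this], this⟩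
    · rintro ⟨z, hz, rfl⟩
      exact ⟨by simp [φ, Real.exp_pos], hz⟩
  rw [himg]
  exact ((hfin.preimage hinj.injOn).countable.isConnected_compl_of_one_lt_rank
    (by simp)).isPreconnected.image _ hφ.continuousOn

theorem hasDerivAt_inv_Gamma_zero : HasDerivAt (fun s : ℂ => (Gamma s)⁻¹) 1 0 := by
  have h1 : (fun s : ℂ => (Gamma s)⁻¹) = fun s => s * (Gamma (s + 1))⁻¹ :=
    funext one_div_Gamma_eq_self_mul_one_div_Gamma_add_one
  rw [h1]
  have h2 : DifferentiableAt ℂ (fun s : ℂ => (Gamma (s + 1))⁻¹) 0 :=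
    (differentiable_one_div_Gamma.comp (differentiable_id.add_const 1)) 0
  exact ((hasDerivAt_id (0 : ℂ)).mul h2.hasDerivAt).congr_deriv (by simp)

/-- A linear combination of log-gamma functions whose integrand vanishes at `0` is the integral
of that integrand against `dt / t`. -/
theorem sum_mul_logGamma {ι : Type*} (S : Finset ι) (ε w : ι → ℂ) {m : ℕ} {a : Fin m → ℝ}
    (ha : ∀ j, 0 < a j) {δ : ℝ} (hδ : 0 < δ) (hw : ∀ k ∈ S, δ ≤ (w k).re)
    (h0 : (fun t : ℝ => ∑ k ∈ S, ε k * barnesIntegrand a (w k) t) =O[𝓝[>] 0] fun t : ℝ => t) :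
    MellinConvergent (fun t : ℝ => ∑ k ∈ S, ε k * barnesIntegrand a (w k) t) 0 ∧
    ∑ k ∈ S, ε k * logGamma a (w k) =
      mellin (fun t : ℝ => ∑ k ∈ S, ε k * barnesIntegrand a (w k) t) 0 := by
  set H : ℝ → ℂ := fun t : ℝ => ∑ k ∈ S, ε k * barnesIntegrand a (w k) t with hH
  have hc := fun k hk => isZetaContinuation_barnesZeta ha (hδ.trans_le (hw k hk))
  have hHc : ContinuousOn H (Ioi 0) := continuousOn_finsetSum _ fun k _ =>
    continuousOn_const.mul (continuousOn_barnesIntegrand ha _)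
  have hHl := hHc.locallyIntegrableOn (μ := volume) measurableSet_Ioi
  have hHt : H =O[atTop] fun t => Real.exp (-δ * t) := IsBigO.fun_sum fun k hk =>
    (isBigO_barnesIntegrand_atTop ha (hw k hk)).const_mul_left _
  -- Vanishing to first order at `0` moves the edge of holomorphy of `mellin H` to `Re s = -1`, so
  -- that `s = 0` is interior.
  have hH0 : H =O[𝓝[>] 0] fun t : ℝ => t ^ (-(-1 : ℝ)) := by simpa using h0
  have hHd : ∀ s : ℂ, -1 < s.re → DifferentiableAt ℂ (mellin H) s := fun s hs =>
    mellin_differentiableAt_of_isBigO_rpow_exp hδ hHl hHt hH0 hs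
  have hdom : (0 : ℂ) ∈ zetaDomain m := by
    rintro ⟨k, hk, hk'⟩
    have h1 : k = 0 := Nat.cast_eq_zero.1 hk'
    have := hk.1
    omega
  have hUo : IsOpen ({s : ℂ | (-1 : ℝ) < s.re} ∩ zetaDomain m) :=
    (isOpen_lt continuous_const continuous_re).inter (isOpen_zetaDomain m)
  -- Identity theorem: both sides agree for `Re s > m` by linearity of the convergent integrals.
  have heq : EqOn (fun s => ∑ k ∈ S, ε k * barnesZeta a (w k) s)
      (fun s => (Gamma s)⁻¹ * mellin H s) ({s : ℂ | (-1 : ℝ) < s.re} ∩ zetaDomain m) := by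
    have h1 : DifferentiableOn ℂ (fun s => ∑ k ∈ S, ε k * barnesZeta a (w k) s)
        ({s : ℂ | (-1 : ℝ) < s.re} ∩ zetaDomain m) :=
      DifferentiableOn.fun_sum fun k hk => (((hc k hk).1).mono inter_subset_right).const_mul _
    have h2 : DifferentiableOn ℂ (fun s => (Gamma s)⁻¹ * mellin H s)
        ({s : ℂ | (-1 : ℝ) < s.re} ∩ zetaDomain m) := fun s hs =>
      ((differentiable_one_div_Gamma s).mul (hHd s hs.1)).differentiableWithinAt
    have hm : (m : ℝ) < ((m : ℂ) + 1).re := by simp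
    have hmem : ((m : ℂ) + 1) ∈ {s : ℂ | (-1 : ℝ) < s.re} ∩ zetaDomain m := by
      refine ⟨?_, mem_zetaDomain_of_lt_re hm⟩
      have : (0 : ℝ) ≤ m := m.cast_nonneg
      exact lt_of_lt_of_le (by norm_num) (this.trans hm.le)
    refine (h1.analyticOnNhd hUo).eqOn_of_preconnected_of_eventuallyEq (h2.analyticOnNhd hUo)
      (isPreconnected_halfPlane_inter_zetaDomain m _) hmem ?_
    have hU : {s : ℂ | (m : ℝ) < s.re} ∈ 𝓝 ((m : ℂ) + 1) :=
      (isOpen_lt continuous_const continuous_re).mem_nhds hm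
    filter_upwards [hU] with s hs
    have hcv : ∀ k ∈ S, MellinConvergent (barnesIntegrand a (w k)) s := fun k hk =>
      mellinConvergent_barnesIntegrand ha (hδ.trans_le (hw k hk)) hs
    have h3 : mellin H s = ∑ k ∈ S, ε k * mellin (barnesIntegrand a (w k)) s := by
      simp only [mellin, hH, Finset.smul_sum]
      rw [integral_finsetSum _ fun k hk => ?_]
      · refine Finset.sum_congr rfl fun k _ => ?_
        rw [← integral_const_mul]
        simp only [smul_eq_mul, mul_left_comm]
      · have := (hcv k hk).const_smul (ε k)
        simpa only [MellinConvergent, IntegrableOn, smul_eq_mul] using this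
    rw [h3, Finset.mul_sum]
    refine Finset.sum_congr rfl fun k hk => ?_
    rw [(hc k hk).2 s hs, zetaIntegral_eq_mellin]
    ring
  have h1 : HasDerivAt (fun s => ∑ k ∈ S, ε k * barnesZeta a (w k) s)
      (∑ k ∈ S, ε k * logGamma a (w k)) 0 :=
    HasDerivAt.fun_sum fun k hk => (((hc k hk).1.differentiableAt
      ((isOpen_zetaDomain m).mem_nhds hdom)).hasDerivAt.const_mul (ε k))
  -- As `1/Γ` has value `0` and derivative `1` at `0`, only `mellin H 0` survives in the product
  -- rule.
  have h2 : HasDerivAt (fun s => (Gamma s)⁻¹ * mellin H s) (mellin H 0) 0 := by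
    exact (hasDerivAt_inv_Gamma_zero.mul (hHd 0 (by simp)).hasDerivAt).congr_deriv
      (by simp [Gamma_zero])
  exact ⟨mellinConvergent_of_isBigO_rpow_exp hδ hHl hHt hH0 (by simp), h1.unique (h2.congr_of_eventuallyEq
    (heq.eventuallyEq_of_mem (hUo.mem_nhds ⟨by simp, hdom⟩)))⟩

/-! ### The alternating sum `opS` and the Lévy density. -/

theorem opS_eq_sum_powerset {N : ℕ} (f : ℂ → ℂ) (q : ℂ) (b : Fin (N + 1) → ℝ) :
    opS f q b = ∑ K ∈ (Finset.univ : Finset (Fin N)).powerset,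
      (-1 : ℂ) ^ K.card * f (q + (b 0 : ℂ) + ∑ k ∈ K, (b k.succ : ℂ)) := by
  rw [Finset.sum_powerset, opS, Finset.card_univ, Fintype.card_fin]
  refine Finset.sum_congr rfl fun p _ => ?_
  rw [Finset.mul_sum]
  refine Finset.sum_congr rfl fun K hK => ?_
  rw [(Finset.mem_powersetCard.1 hK).2]

/-- `t` times the Lévy density attached to `(a, b)`. -/
noncomputable def levyRatio {m N : ℕ} (a : Fin m → ℝ) (b : Fin (N + 1) → ℝ) (t : ℝ) : ℝ :=
  Real.exp (-b 0 * t) * (∏ j : Fin N, (1 - Real.exp (-b j.succ * t))) *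
    ∏ j : Fin m, (1 - Real.exp (-a j * t))⁻¹

theorem sum_powerset_barnesIntegrand {m N : ℕ} (a : Fin m → ℝ) (b : Fin (N + 1) → ℝ) (q : ℂ)
    (t : ℝ) :
    ∑ K ∈ (Finset.univ : Finset (Fin N)).powerset,
      (-1 : ℂ) ^ K.card * barnesIntegrand a (q + (b 0 : ℂ) + ∑ k ∈ K, (b k.succ : ℂ)) t =
      exp (-q * t) * levyRatio a b t := by
  have h1 := Finset.prod_sub (fun _ : Fin N => (1 : ℂ))
    (fun j => exp (-(b j.succ : ℂ) * t)) Finset.univ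
  simp only [levyRatio, barnesIntegrand]
  push_cast
  rw [h1, Finset.mul_sum, Finset.sum_mul, Finset.mul_sum]
  refine Finset.sum_congr rfl fun K _ => ?_
  rw [← exp_sum, Finset.prod_const_one, mul_one,
    show -(q + (b 0 : ℂ) + ∑ k ∈ K, (b k.succ : ℂ)) * t =
      -q * t + (-(b 0 : ℂ) * t + ∑ k ∈ K, -(b k.succ : ℂ) * t) by
        rw [← Finset.sum_mul, Finset.sum_neg_distrib]; ring,
    exp_add, exp_add]
  ring

/-- For `β ≤ 1` this is monotonicity; for `β ≥ 1` it is Bernoulli's inequality at `e^{-t}`. -/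
theorem one_sub_exp_le {β t : ℝ} (ht : 0 < t) :
    1 - Real.exp (-β * t) ≤ max 1 β * (1 - Real.exp (-t)) := by
  have h0 : 0 ≤ 1 - Real.exp (-t) := by
    simpa using ht.le
  rcases le_total β 1 with h | h
  · rw [max_eq_left h, one_mul, sub_le_sub_iff_left, Real.exp_le_exp]
    nlinarith
  · rw [max_eq_right h]
    have := one_add_mul_self_le_rpow_one_add (s := Real.exp (-t) - 1)
      (by linarith [Real.exp_pos (-t)]) h
    rw [add_sub_cancel, ← Real.exp_mul] at this
    rw [show -β * t = -t * β by ring]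
    linarith

theorem inv_one_sub_exp_le {α t : ℝ} (hα : 0 < α) (ht : 0 < t) :
    (1 - Real.exp (-α * t))⁻¹ ≤ max 1 α⁻¹ * (1 - Real.exp (-t))⁻¹ := by
  have h1 := one_sub_exp_le (β := α⁻¹) (mul_pos hα ht)
  have h2 := one_sub_exp_pos hα ht
  have h3 := one_sub_exp_pos one_pos ht
  rw [show -α⁻¹ * (α * t) = -t by field_simp, ← neg_mul] at h1
  rw [neg_one_mul] at h3
  rw [← div_eq_mul_inv, le_div_iff₀ h3, inv_mul_le_iff₀ h2, mul_comm]
  exact h1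

section

variable {m N : ℕ} {a : Fin m → ℝ} {b : Fin (N + 1) → ℝ} (ha : ∀ j, 0 < a j) (hb : ∀ j, 0 < b j)

include ha hb

theorem levyRatio_nonneg {t : ℝ} (ht : 0 < t) : 0 ≤ levyRatio a b t :=
  mul_nonneg (mul_nonneg (Real.exp_pos _).le
    (Finset.prod_nonneg fun _ _ => (one_sub_exp_pos (hb _) ht).le))
    (Finset.prod_nonneg fun j _ => (inv_pos.2 (one_sub_exp_pos (ha j) ht)).le)

/-- Every factor is comparable to `1 - e^{-t}`, with `N` of them upstairs and `m` downstairs. The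
bound gives both the decay rate `b 0` and the order of vanishing at `0`. -/
theorem exists_levyRatio_le (h : m ≤ N) : ∃ C : ℝ, 0 < C ∧ ∀ t : ℝ, 0 < t →
    levyRatio a b t ≤ C * Real.exp (-b 0 * t) * (1 - Real.exp (-t)) ^ (N - m) := by
  refine ⟨(∏ j : Fin N, max 1 (b j.succ)) * ∏ j : Fin m, max 1 (a j)⁻¹, ?_, fun t ht => ?_⟩
  · exact mul_pos (Finset.prod_pos fun j _ => by positivity)
      (Finset.prod_pos fun j _ => by positivity)
  have hu : 0 < 1 - Real.exp (-t) := by simpa using one_sub_exp_pos one_pos ht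
  have h1 : ∏ j : Fin N, (1 - Real.exp (-b j.succ * t)) ≤
      (∏ j : Fin N, max 1 (b j.succ)) * (1 - Real.exp (-t)) ^ N := by
    have := Finset.prod_le_prod (s := Finset.univ)
      (fun (j : Fin N) _ => (one_sub_exp_pos (hb j.succ) ht).le)
      (fun (j : Fin N) _ => one_sub_exp_le (β := b j.succ) ht)
    simpa [Finset.prod_mul_distrib] using this
  have h2 : ∏ j : Fin m, (1 - Real.exp (-a j * t))⁻¹ ≤
      (∏ j : Fin m, max 1 (a j)⁻¹) * ((1 - Real.exp (-t)) ^ m)⁻¹ := by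
    have := Finset.prod_le_prod (s := Finset.univ)
      (fun (j : Fin m) _ => (inv_pos.2 (one_sub_exp_pos (ha j) ht)).le)
      (fun (j : Fin m) _ => inv_one_sub_exp_le (ha j) ht)
    simpa only [Finset.prod_mul_distrib, Finset.prod_const, Finset.card_univ, Fintype.card_fin,
      inv_pow] using this
  have h3 : 0 ≤ ∏ j : Fin m, (1 - Real.exp (-a j * t))⁻¹ :=
    Finset.prod_nonneg fun j _ => (inv_pos.2 (one_sub_exp_pos (ha j) ht)).le
  have h4 : 0 ≤ (∏ j : Fin N, max 1 (b j.succ)) * (1 - Real.exp (-t)) ^ N := by positivity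
  calc levyRatio a b t = Real.exp (-b 0 * t) * ((∏ j : Fin N, (1 - Real.exp (-b j.succ * t))) *
        ∏ j : Fin m, (1 - Real.exp (-a j * t))⁻¹) := mul_assoc _ _ _
    _ ≤ Real.exp (-b 0 * t) * (((∏ j : Fin N, max 1 (b j.succ)) * (1 - Real.exp (-t)) ^ N) *
        ((∏ j : Fin m, max 1 (a j)⁻¹) * ((1 - Real.exp (-t)) ^ m)⁻¹)) := by
      gcongr
    _ = _ := by
      rw [pow_sub₀ _ hu.ne' h]
      ring

theorem levyRatio_isBigO_one (h : m ≤ N) : levyRatio a b =O[𝓝[>] 0] fun _ => (1 : ℝ) := by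
  obtain ⟨C, hC, hle⟩ := exists_levyRatio_le ha hb h
  refine IsBigO.of_bound C ?_
  filter_upwards [self_mem_nhdsWithin] with t ht
  have ht : 0 < t := ht
  rw [Real.norm_of_nonneg (levyRatio_nonneg ha hb ht), norm_one, mul_one]
  refine (hle t ht).trans ?_
  have h1 : Real.exp (-b 0 * t) ≤ 1 := by
    have := one_sub_exp_pos (hb 0) ht
    linarith
  have h2 : 0 ≤ 1 - Real.exp (-t) := by simpa using ht.le
  have h3 : (1 - Real.exp (-t)) ^ (N - m) ≤ 1 :=
    pow_le_one₀ h2 (by linarith [Real.exp_pos (-t)])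
  calc C * Real.exp (-b 0 * t) * (1 - Real.exp (-t)) ^ (N - m) ≤ C * 1 * 1 := by gcongr
    _ = C := by ring

theorem levyRatio_isBigO_id (h : m < N) : levyRatio a b =O[𝓝[>] 0] fun t : ℝ => t := by
  obtain ⟨C, hC, hle⟩ := exists_levyRatio_le ha hb h.le
  refine IsBigO.of_bound C ?_
  filter_upwards [self_mem_nhdsWithin] with t ht
  have ht : 0 < t := ht
  rw [Real.norm_of_nonneg (levyRatio_nonneg ha hb ht), Real.norm_of_nonneg ht.le]
  refine (hle t ht).trans ?_
  have h1 : Real.exp (-b 0 * t) ≤ 1 := by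
    have := one_sub_exp_pos (hb 0) ht
    linarith
  have h2 : 0 ≤ 1 - Real.exp (-t) := by simpa using ht.le
  have h3 : (1 - Real.exp (-t)) ^ (N - m) ≤ t :=
    (pow_le_of_le_one h2 (by linarith [Real.exp_pos (-t)]) (by omega)).trans
      (by linarith [Real.one_sub_le_exp_neg t])
  calc C * Real.exp (-b 0 * t) * (1 - Real.exp (-t)) ^ (N - m) ≤ C * 1 * t := by gcongr
    _ = C * t := by ring

theorem opS_logGamma_eq (h : m < N) {q : ℂ} (hq : -b 0 < q.re) :
    MellinConvergent (fun t : ℝ => exp (-q * t) * levyRatio a b t) 0 ∧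
    opS (logGamma a) q b = mellin (fun t : ℝ => exp (-q * t) * levyRatio a b t) 0 := by
  have key := sum_mul_logGamma (Finset.univ : Finset (Fin N)).powerset
    (fun K => (-1 : ℂ) ^ K.card) (fun K => q + (b 0 : ℂ) + ∑ k ∈ K, (b k.succ : ℂ)) ha
    (δ := q.re + b 0) (by linarith) (fun K _ => by
      simpa [← ofReal_sum] using Finset.sum_nonneg fun k (_ : k ∈ K) => (hb k.succ).le)
  simp only [sum_powerset_barnesIntegrand, ← opS_eq_sum_powerset] at key
  refine key ?_
  have h1 : (fun t : ℝ => exp (-q * t)) =O[𝓝[>] 0] fun _ => (1 : ℝ) :=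
    ((Continuous.tendsto (by fun_prop) 0).mono_left nhdsWithin_le_nhds).isBigO_one ℝ
  have h2 : (fun t : ℝ => (levyRatio a b t : ℂ)) =O[𝓝[>] 0] fun t : ℝ => t :=
    isBigO_ofReal_left.2 (levyRatio_isBigO_id ha hb h)
  simpa using h1.mul h2

/-- When `m = N` the density ratio need not vanish at `0`; subtracting the value at `q = 0` supplies
the missing factor `e^{-qt} - 1 = O(t)`. -/
theorem opS_logGamma_sub_eq (h : m ≤ N) {q : ℂ} (hq : -b 0 < q.re) :
    MellinConvergent (fun t : ℝ => (exp (-q * t) - 1) * levyRatio a b t) 0 ∧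
    opS (logGamma a) q b - opS (logGamma a) 0 b =
      mellin (fun t : ℝ => (exp (-q * t) - 1) * levyRatio a b t) 0 := by
  have hb0 := hb 0
  -- The Boolean index selects the shift `q` or `0`, so the difference is one linear combination and
  -- its integrand vanishes at `0` as a whole.
  have key := sum_mul_logGamma
    ((Finset.univ : Finset (Fin N)).powerset ×ˢ (Finset.univ : Finset Bool))
    (fun K => (-1 : ℂ) ^ K.1.card * if K.2 then 1 else -1)
    (fun K => (if K.2 then q else 0) + (b 0 : ℂ) + ∑ k ∈ K.1, (b k.succ : ℂ)) ha
    (δ := min q.re 0 + b 0) (by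
      rcases min_choice q.re 0 with h | h <;> rw [h] <;> linarith) (fun K _ => by
      have h1 : 0 ≤ ∑ k ∈ K.1, b k.succ := Finset.sum_nonneg fun k _ => (hb k.succ).le
      have h2 : min q.re 0 ≤ (if K.2 then q else 0 : ℂ).re := by
        split_ifs <;> simp
      simp only [add_re, ofReal_re, ← ofReal_sum]
      linarith)
  have hsum : ∀ F : ℂ → ℂ, ∑ K ∈ (Finset.univ : Finset (Fin N)).powerset ×ˢ
      (Finset.univ : Finset Bool), ((-1 : ℂ) ^ K.1.card * if K.2 then 1 else -1) *
        F ((if K.2 then q else 0) + (b 0 : ℂ) + ∑ k ∈ K.1, (b k.succ : ℂ)) =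
      opS F q b - opS F 0 b := fun F => by
    rw [Finset.sum_product, opS_eq_sum_powerset, opS_eq_sum_powerset, ← Finset.sum_sub_distrib]
    refine Finset.sum_congr rfl fun K _ => ?_
    rw [Fintype.sum_bool]
    simp only [if_true, Bool.false_eq_true, if_false]
    ring
  have hint : ∀ t : ℝ, opS (fun w => barnesIntegrand a w t) q b -
      opS (fun w => barnesIntegrand a w t) 0 b = (exp (-q * t) - 1) * levyRatio a b t := by
    intro t
    rw [opS_eq_sum_powerset, opS_eq_sum_powerset, sum_powerset_barnesIntegrand,
      sum_powerset_barnesIntegrand]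
    simp
    ring
  simp only [fun t => (hsum fun w => barnesIntegrand a w t).trans (hint t), hsum] at key
  refine key ?_
  have h1 : (fun t : ℝ => exp (-q * t) - 1) =O[𝓝[>] 0] fun t : ℝ => t := by
    have hd : DifferentiableAt ℝ (fun t : ℝ => exp (-q * t)) 0 := by fun_prop
    simpa using hd.isBigO_sub.mono (nhdsWithin_le_nhds (s := Ioi 0))
  have h2 : (fun t : ℝ => (levyRatio a b t : ℂ)) =O[𝓝[>] 0] fun _ : ℝ => (1 : ℝ) :=
    isBigO_ofReal_left.2 (levyRatio_isBigO_one ha hb h)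
  simpa using h1.mul h2

end

/-- Deleting `a i` multiplies the Lévy ratio by `1 - e^{-a_i t}`, and the sum of `e^{-l a_i t}` over
`l < k` times this factor is `1 - e^{-k a_i t}`. With one parameter fewer the strict inequality `M <
N` holds, so each summand is a convergent integral by itself. -/
theorem neg_sum_opS_logGamma_removeNth {M N : ℕ} (hMN : M + 1 ≤ N) {a : Fin (M + 1) → ℝ}
    (ha : ∀ j, 0 < a j) {b : Fin (N + 1) → ℝ} (hb : ∀ j, 0 < b j) (i : Fin (M + 1)) (k : ℕ) :
    -∑ l ∈ Finset.range k, opS (logGamma (i.removeNth a)) ((l : ℂ) * (a i : ℂ)) b =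
      opS (logGamma a) ((k : ℂ) * (a i : ℂ)) b - opS (logGamma a) 0 b := by
  have hre : ∀ l : ℕ, -b 0 < ((l : ℂ) * (a i : ℂ)).re := fun l => by
    have h1 : 0 ≤ (l : ℝ) * a i := mul_nonneg l.cast_nonneg (ha i).le
    have h2 := hb 0
    simp only [mul_re, natCast_re, ofReal_re, natCast_im, ofReal_im]
    linarith
  have ha' : ∀ j, 0 < i.removeNth a j := fun j => ha _
  rw [(opS_logGamma_sub_eq ha hb hMN (hre k)).2,
    Finset.sum_congr rfl fun l _ => (opS_logGamma_eq ha' hb hMN (hre l)).2]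
  simp only [mellin]
  rw [← integral_finsetSum _ fun l _ => (opS_logGamma_eq ha' hb hMN (hre l)).1, ← integral_neg]
  refine setIntegral_congr_fun measurableSet_Ioi fun t ht => ?_
  simp only [smul_eq_mul, ← Finset.mul_sum, ← Finset.sum_mul]
  have hgeom : ∑ l ∈ Finset.range k, exp (-((l : ℂ) * (a i : ℂ)) * t) *
      (1 - exp (-(a i : ℂ) * t)) = 1 - exp (-((k : ℂ) * (a i : ℂ)) * t) := by
    have h1 : ∀ l : ℕ, exp (-((l : ℂ) * (a i : ℂ)) * t) = exp (-(a i : ℂ) * t) ^ l := fun l => by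
      rw [← exp_nat_mul]
      ring_nf
    simp only [h1]
    rw [← Finset.sum_mul]
    linear_combination -(geom_sum_mul (exp (-(a i : ℂ) * t)) k)
  have hratio : (levyRatio a b t : ℂ) =
      (1 - exp (-(a i : ℂ) * t))⁻¹ * levyRatio (i.removeNth a) b t := by
    simp only [levyRatio, Fin.prod_univ_succAbove _ i, Fin.removeNth]
    push_cast
    ring
  have hne := one_sub_cexp_ne_zero (ha i) ht
  rw [hratio]
  rw [← Finset.sum_mul] at hgeom
  rw [show exp (-((k : ℂ) * (a i : ℂ)) * t) - 1 = -((∑ l ∈ Finset.range k,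
    exp (-((l : ℂ) * (a i : ℂ)) * t)) * (1 - exp (-(a i : ℂ) * t))) by rw [hgeom]; ring]
  have halg : ∀ P S D R : ℂ, D ≠ 0 → -(P * (S * R)) = P * (-(S * D) * (D⁻¹ * R)) := by
    intro P S D R hD
    field_simp
  exact halg _ _ _ _ hne

/-! ### Laplace transforms on the half-line and Ramanujan's master formula. -/

/-- The Laplace transform of a measure on the real line. -/
noncomputable def laplaceTransform (P : Measure ℝ) (z : ℂ) : ℂ := ∫ t : ℝ, exp (-z * t) ∂P

/-- The Laplace transform at `x` of the image of `P` under `t ↦ exp (-α t)`. -/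
noncomputable def expLaplace (P : Measure ℝ) (α : ℝ) (x : ℂ) : ℂ :=
  ∫ t : ℝ, exp (-(x * Real.exp (-α * t))) ∂P

theorem exp_neg_le_rpow {p y : ℝ} (hp : 0 < p) (hy : 0 < y) :
    Real.exp (-y) ≤ p ^ p * y ^ (-p) := by
  have h1 : y / p ≤ Real.exp (y / p) := by linarith [Real.add_one_le_exp (y / p)]
  have h2 : (y / p) ^ p ≤ Real.exp y := by
    refine (Real.rpow_le_rpow (by positivity) h1 hp.le).trans_eq ?_
    rw [← Real.exp_mul, div_mul_cancel₀ _ hp.ne']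
  rw [Real.div_rpow hy.le hp.le] at h2
  rw [Real.exp_neg, Real.rpow_neg hy.le, ← div_eq_mul_inv, inv_le_comm₀ (Real.exp_pos _)
    (by positivity), inv_div]
  exact h2

theorem norm_exp_neg_ofReal_mul (x t α : ℝ) :
    ‖exp (-((x : ℂ) * Real.exp (-α * t)))‖ = Real.exp (-(x * Real.exp (-α * t))) := by
  rw [norm_exp, ← ofReal_mul, ← ofReal_neg, ofReal_re]

theorem integrableOn_rpow_mul_exp_neg {σ r : ℝ} (hσ : 0 < σ) (hr : 0 < r) :
    IntegrableOn (fun x : ℝ => x ^ (σ - 1) * Real.exp (-(r * x))) (Ioi 0) := by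
  by_contra h
  have h1 := Real.integral_rpow_mul_exp_neg_mul_Ioi hσ hr
  rw [integral_undef h] at h1
  have := Real.Gamma_pos_of_pos hσ
  exact (by positivity : (1 / r) ^ σ * Real.Gamma σ ≠ 0) h1.symm

section

variable {P : Measure ℝ} [IsProbabilityMeasure P] (hP : ∀ᵐ t ∂P, 0 ≤ t) {α : ℝ} (hα : 0 < α)

include hP

theorem norm_laplaceTransform_le_one {z : ℂ} (hz : 0 ≤ z.re) : ‖laplaceTransform P z‖ ≤ 1 := by
  have := norm_integral_le_of_norm_le_const (μ := P) (f := fun t : ℝ => exp (-z * t)) (C := 1) (by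
    filter_upwards [hP] with t ht
    rw [norm_exp, Real.exp_le_one_iff]
    simp only [neg_mul, neg_re, re_mul_ofReal]
    nlinarith)
  simpa [laplaceTransform] using this

include hα

theorem hasSum_expLaplace (x : ℂ) :
    HasSum (fun k : ℕ => (-x) ^ k / (k.factorial : ℂ) * laplaceTransform P (k * α))
      (expLaplace P α x) := by
  have hterm : ∀ (k : ℕ) (t : ℝ), (-(x * Real.exp (-α * t))) ^ k / (k.factorial : ℂ) =
      (-x) ^ k / (k.factorial : ℂ) * exp (-((k : ℂ) * α) * t) := fun k t => by
    rw [neg_mul_eq_neg_mul, mul_pow, ofReal_exp, ← exp_nat_mul]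
    push_cast
    ring_nf
  have := hasSum_integral_of_dominated_convergence (μ := P)
    (F := fun (k : ℕ) (t : ℝ) => (-(x * Real.exp (-α * t))) ^ k / (k.factorial : ℂ))
    (f := fun t : ℝ => exp (-(x * Real.exp (-α * t))))
    (fun k _ => ‖x‖ ^ k / (k.factorial : ℝ))
    (fun k => (by fun_prop : Continuous _).aestronglyMeasurable)
    (fun k => by
      filter_upwards [hP] with t ht
      rw [norm_div, norm_pow, norm_neg, norm_mul, norm_natCast, norm_real,
        Real.norm_of_nonneg (Real.exp_pos _).le]
      gcongr
      refine mul_le_of_le_one_right (norm_nonneg _) (Real.exp_le_one_iff.2 ?_)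
      nlinarith)
    (Eventually.of_forall fun _ => Real.summable_pow_div_factorial _)
    (integrable_const _)
    (Eventually.of_forall fun t => by
      rw [exp_eq_exp_ℂ]
      exact NormedSpace.expSeries_div_hasSum_exp _)
  simp only [hterm, integral_const_mul] at this
  exact this

omit hP hα in
theorem norm_expLaplace_le_one {x : ℝ} (hx : 0 ≤ x) : ‖expLaplace P α x‖ ≤ 1 := by
  have := norm_integral_le_of_norm_le_const (μ := P)
    (f := fun t : ℝ => exp (-((x : ℂ) * Real.exp (-α * t)))) (C := 1)
    (Eventually.of_forall fun t => by
      rw [norm_exp_neg_ofReal_mul, Real.exp_le_one_iff]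
      have := Real.exp_pos (-α * t)
      nlinarith)
  simpa [expLaplace] using this

omit hP hα [IsProbabilityMeasure P] in
-- A Markov-type bound: `e^{-y} ≤ p^p y^{-p}` at `y = x e^{-αt}` trades an exponential moment for
-- decay in `x`. The constant depends on the measure only through that moment, so it is uniform
-- along a sequence with convergent transforms.
theorem norm_expLaplace_le_rpow {p x : ℝ} (hp : 0 < p) (hx : 0 < x)
    (hint : Integrable (fun t : ℝ => exp (-(-(p : ℂ) * α) * t)) P) :
    ‖expLaplace P α x‖ ≤ p ^ p * ‖laplaceTransform P (-(p : ℂ) * α)‖ * x ^ (-p) := by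
  have hreal : ∀ t : ℝ, exp (-(-(p : ℂ) * α) * t) = (Real.exp (p * α * t) : ℂ) := fun t => by
    push_cast
    ring_nf
  have hL : ‖laplaceTransform P (-(p : ℂ) * α)‖ = ∫ t : ℝ, Real.exp (p * α * t) ∂P := by
    simp only [laplaceTransform, hreal]
    rw [integral_complex_ofReal, norm_real]
    exact Real.norm_of_nonneg (integral_nonneg fun t => (Real.exp_pos _).le)
  have hint' : Integrable (fun t : ℝ => Real.exp (p * α * t)) P := by
    refine hint.norm.congr (Eventually.of_forall fun t => ?_)
    simp only [hreal, norm_real]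
    exact Real.norm_of_nonneg (Real.exp_pos _).le
  rw [hL, mul_right_comm, ← integral_const_mul]
  refine norm_integral_le_of_norm_le (hint'.const_mul _) (Eventually.of_forall fun t => ?_)
  rw [norm_exp_neg_ofReal_mul]
  refine (exp_neg_le_rpow hp (mul_pos hx (Real.exp_pos _))).trans_eq ?_
  rw [Real.mul_rpow hx.le (Real.exp_pos _).le, ← Real.exp_mul]
  ring_nf

omit hP hα in
theorem integral_cpow_mul_expLaplace {q : ℂ} (hq : 0 < q.re)
    (hint : Integrable (fun t : ℝ => exp (-(-q * α) * t)) P) :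
    ∫ x in Ioi (0 : ℝ), (x : ℂ) ^ (q - 1) * expLaplace P α x =
      Gamma q * laplaceTransform P (-q * α) := by
  have hr : ∀ t : ℝ, 0 < Real.exp (-α * t) := fun t => Real.exp_pos _
  let G : ℝ → ℝ → ℂ := fun x t => (x : ℂ) ^ (q - 1) * exp (-((x : ℂ) * Real.exp (-α * t)))
  have hnorm : ∀ t : ℝ, ∀ x ∈ Ioi (0 : ℝ),
      ‖G x t‖ = x ^ (q.re - 1) * Real.exp (-(Real.exp (-α * t) * x)) := fun t x hx => by
    simp only [G]
    rw [norm_mul, norm_exp_neg_ofReal_mul, norm_cpow_eq_rpow_re_of_pos hx, sub_re, one_re,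
      mul_comm x]
  have hmeas : Measurable (Function.uncurry G) := by
    simp only [G, Function.uncurry_def]
    exact ((measurable_ofReal.comp measurable_fst).pow_const _).mul (by fun_prop)
  have hG : Integrable (Function.uncurry G) ((volume.restrict (Ioi 0)).prod P) := by
    rw [integrable_prod_iff' hmeas.aestronglyMeasurable]
    refine ⟨Eventually.of_forall fun t => ?_, ?_⟩
    · rw [← integrable_norm_iff]
      · exact (integrableOn_rpow_mul_exp_neg hq (hr t)).congr_fun
          (fun x hx => (hnorm t x hx).symm) measurableSet_Ioi
      · exact (hmeas.comp measurable_prodMk_right).aestronglyMeasurable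
    · refine (hint.norm.const_mul (Real.Gamma q.re)).congr (Eventually.of_forall fun t => ?_)
      simp only [Function.uncurry_apply_pair]
      rw [setIntegral_congr_fun measurableSet_Ioi (hnorm t),
        Real.integral_rpow_mul_exp_neg_mul_Ioi hq (hr t), norm_exp, one_div, ← Real.exp_neg,
        ← Real.exp_mul, mul_comm]
      congr 2
      simp [mul_comm, mul_left_comm]
  have hswap := integral_integral_swap hG
  simp only [G, integral_const_mul] at hswap
  unfold expLaplace
  rw [hswap, laplaceTransform, ← integral_const_mul]
  refine integral_congr_ae (Eventually.of_forall fun t => ?_)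
  have h1 := integral_cpow_mul_exp_neg_mul_Ioi hq (hr t)
  simp only [mul_comm ((Real.exp (-α * t) : ℝ) : ℂ)] at h1
  simp only [h1]
  rw [mul_comm, one_div, ← ofReal_inv, ← Real.exp_neg, cpow_def_of_ne_zero
    (ofReal_ne_zero.2 (Real.exp_pos _).ne'), ← ofReal_log (Real.exp_pos _).le, Real.log_exp]
  push_cast
  ring_nf

end

/-- Ramanujan's master formula for limits of Laplace transforms of probability measures on the
half-line. -/
theorem mellin_tsum_of_tendsto_laplaceTransform (P : ℕ → Measure ℝ)
    [∀ n, IsProbabilityMeasure (P n)] (hP : ∀ n, ∀ᵐ t ∂P n, 0 ≤ t) {α β : ℝ} (hα : 0 < α)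
    (hβ : 0 < β) (Φ : ℂ → ℂ)
    (hint : ∀ n (z : ℂ), -β < z.re → Integrable (fun t : ℝ => exp (-z * t)) (P n))
    (hlim : ∀ z : ℂ, -β < z.re → Tendsto (fun n => laplaceTransform (P n) z) atTop (𝓝 (Φ z))) :
    (∀ x : ℂ, Summable fun k : ℕ => (-x) ^ k / (k.factorial : ℂ) * Φ (k * α)) ∧
    ∀ q : ℂ, 0 < q.re → q.re < β / α →
      IntegrableOn (fun x : ℝ => (x : ℂ) ^ (q - 1) *
        ∑' k : ℕ, (-(x : ℂ)) ^ k / (k.factorial : ℂ) * Φ (k * α)) (Ioi 0) ∧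
      ∫ x in Ioi (0 : ℝ), (x : ℂ) ^ (q - 1) *
        ∑' k : ℕ, (-(x : ℂ)) ^ k / (k.factorial : ℂ) * Φ (k * α) = Gamma q * Φ (-q * α) := by
  have hre : ∀ k : ℕ, 0 ≤ ((k : ℂ) * α).re := fun k => by
    simpa using mul_nonneg k.cast_nonneg hα.le
  have hΦ : ∀ k : ℕ, ‖Φ (k * α)‖ ≤ 1 := fun k =>
    le_of_tendsto (hlim _ (by linarith [hre k])).norm
      (Eventually.of_forall fun n => norm_laplaceTransform_le_one (hP n) (hre k))
  have hbd : ∀ (x : ℂ) (k : ℕ) (c : ℂ), ‖c‖ ≤ 1 →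
      ‖(-x) ^ k / (k.factorial : ℂ) * c‖ ≤ ‖x‖ ^ k / (k.factorial : ℝ) := fun x k c hc => by
    rw [norm_mul, norm_div, norm_pow, norm_neg, norm_natCast]
    exact mul_le_of_le_one_right (by positivity) hc
  refine ⟨fun x => Summable.of_norm_bounded (Real.summable_pow_div_factorial ‖x‖)
    fun k => hbd x k _ (hΦ k), fun q hq0 hq1 => ?_⟩
  have hF : ∀ x : ℂ, Tendsto (fun n => expLaplace (P n) α x) atTop
      (𝓝 (∑' k : ℕ, (-x) ^ k / (k.factorial : ℂ) * Φ (k * α))) := fun x => by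
    have := tendsto_tsum_of_dominated_convergence (𝓕 := atTop)
      (f := fun n (k : ℕ) => (-x) ^ k / (k.factorial : ℂ) * laplaceTransform (P n) (k * α))
      (Real.summable_pow_div_factorial ‖x‖)
      (fun k => (hlim (k * α) (by linarith [hre k])).const_mul _)
      (Eventually.of_forall fun n k =>
        hbd x k _ (norm_laplaceTransform_le_one (hP n) (hre k)))
    exact this.congr fun n => (hasSum_expLaplace (hP n) hα x).tsum_eq
  -- Decay of order `p > Re q` makes the Mellin integral converge at infinity, while `p < β/α` keeps
  -- the `p`-th moment within reach of `hlim`.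
  obtain ⟨p, hqp, hpβ⟩ := exists_between hq1
  have hp : 0 < p := hq0.trans hqp
  have hpα : p * α < β := (lt_div_iff₀ hα).1 hpβ
  have hpre : -β < (-(p : ℂ) * α).re := by
    simpa using hpα
  have hqre : -β < (-q * α).re := by
    have := (lt_div_iff₀ hα).1 hq1
    simpa using this
  -- The added `1` lets this constant dominate the moments of all but finitely many `P n`.
  let B : ℝ := p ^ p * (‖Φ (-(p : ℂ) * α)‖ + 1)
  let g : ℝ → ℝ := fun x => min 1 (B * x ^ (-p))
  have hev : ∀ᶠ n in atTop, ∀ x : ℝ, 0 < x → ‖expLaplace (P n) α x‖ ≤ g x := by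
    filter_upwards [(hlim _ hpre).norm.eventually_lt_const (lt_add_one _)] with n hn x hx
    refine le_min (norm_expLaplace_le_one hx.le)
      ((norm_expLaplace_le_rpow hp hx (hint n _ hpre)).trans ?_)
    exact mul_le_mul_of_nonneg_right (mul_le_mul_of_nonneg_left hn.le (by positivity))
      (by positivity)
  have hB : 0 ≤ B := by positivity
  have hg0 : ∀ x : ℝ, 0 < x → 0 ≤ g x := fun x hx => le_min zero_le_one (by positivity)
  have hgint : IntegrableOn (fun x : ℝ => x ^ (q.re - 1) * g x) (Ioi 0) := by
    refine mellin_convergent_of_isBigO_scalar (a := p) (b := 0) ?_ ?_ hqp ?_ hq0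
    · refine ContinuousOn.locallyIntegrableOn ?_ measurableSet_Ioi
      exact continuousOn_const.inf (continuousOn_const.mul fun x hx =>
        (Real.continuousAt_rpow_const x _ (Or.inl (ne_of_gt hx))).continuousWithinAt)
    · refine IsBigO.of_bound B ?_
      filter_upwards [eventually_gt_atTop 0] with x hx
      rw [Real.norm_of_nonneg (hg0 x hx), Real.norm_of_nonneg (by positivity)]
      exact min_le_right _ _
    · refine IsBigO.of_bound 1 ?_
      filter_upwards [self_mem_nhdsWithin] with x hx
      rw [Real.norm_of_nonneg (hg0 x hx)]
      rw [neg_zero, Real.rpow_zero, norm_one, mul_one]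
      exact min_le_left _ _
  have hnorm : ∀ x ∈ Ioi (0 : ℝ), ‖(x : ℂ) ^ (q - 1)‖ = x ^ (q.re - 1) := fun x hx => by
    rw [norm_cpow_eq_rpow_re_of_pos hx, sub_re, one_re]
  have hmeas : ∀ n, AEStronglyMeasurable
      (fun x : ℝ => (x : ℂ) ^ (q - 1) * expLaplace (P n) α x) (volume.restrict (Ioi 0)) := by
    intro n
    refine ((measurable_ofReal.pow_const _).aestronglyMeasurable).mul ?_
    have : StronglyMeasurable fun x : ℝ =>
        ∫ t : ℝ, exp (-((x : ℂ) * Real.exp (-α * t))) ∂P n :=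
      StronglyMeasurable.integral_prod_right
        (f := fun x t : ℝ => exp (-((x : ℂ) * Real.exp (-α * t))))
        (by fun_prop : Continuous _).stronglyMeasurable
    exact this.aestronglyMeasurable
  have hae : ∀ᵐ x : ℝ ∂volume.restrict (Ioi (0 : ℝ)), Tendsto
      (fun n => (x : ℂ) ^ (q - 1) * expLaplace (P n) α x) atTop (𝓝 ((x : ℂ) ^ (q - 1) *
        ∑' k : ℕ, (-(x : ℂ)) ^ k / (k.factorial : ℂ) * Φ (k * α))) :=
    Eventually.of_forall fun x => (hF x).const_mul _
  have hdom : ∀ᶠ n in atTop, ∀ᵐ x : ℝ ∂volume.restrict (Ioi (0 : ℝ)),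
      ‖(x : ℂ) ^ (q - 1) * expLaplace (P n) α x‖ ≤ x ^ (q.re - 1) * g x := by
    filter_upwards [hev] with n hn
    filter_upwards [ae_restrict_mem measurableSet_Ioi] with x hx
    rw [norm_mul, hnorm x hx]
    exact mul_le_mul_of_nonneg_left (hn x hx) (Real.rpow_nonneg (le_of_lt hx) _)
  constructor
  · refine Integrable.mono' hgint (aestronglyMeasurable_of_tendsto_ae atTop hmeas hae) ?_
    filter_upwards [ae_restrict_mem measurableSet_Ioi] with x hx
    rw [norm_mul, hnorm x hx]
    refine mul_le_mul_of_nonneg_left ?_ (Real.rpow_nonneg (le_of_lt hx) _)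
    exact le_of_tendsto (hF x).norm (hev.mono fun n hn => hn x hx)
  · have h1 := tendsto_integral_filter_of_dominated_convergence _
      (Eventually.of_forall hmeas) hdom hgint hae
    refine tendsto_nhds_unique h1 (((hlim _ hqre).const_mul (Gamma q)).congr fun n => ?_)
    exact (integral_cpow_mul_expLaplace hq0 (hint n _ hqre)).symm

/-! ### Approximation of infinitely divisible laws by convolution powers. -/

/-- A finite measure of mass at most `n`, completed by an atom at `0` and normalized. -/
theorem exists_probabilityMeasure_of_mass_le (ν : Measure ℝ) {n : ℕ} (hn : n ≠ 0)
    (hν : ν univ ≤ n) : ∃ ρ : Measure ℝ, IsProbabilityMeasure ρ ∧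
      ∀ g : ℝ → ℂ, Integrable g ν → Integrable g ρ ∧
        ∫ t, g t ∂ρ = g 0 + (n : ℂ)⁻¹ * ∫ t, (g t - g 0) ∂ν := by
  have hfin : IsFiniteMeasure ν := ⟨hν.trans_lt (ENNReal.natCast_lt_top n)⟩
  have hn' : (n : ENNReal) ≠ 0 := Nat.cast_ne_zero.2 hn
  have hd : (n : ENNReal) - ν univ ≠ ⊤ := ENNReal.sub_ne_top (ENNReal.natCast_ne_top n)
  -- The atom carries the missing mass `n - ν univ`; after division by `n` it produces the term `g
  -- 0` and the compensator inside the integral.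
  refine ⟨(n : ENNReal)⁻¹ • (ν + ((n : ENNReal) - ν univ) • Measure.dirac 0), ⟨?_⟩, fun g hg => ?_⟩
  · simp only [Measure.smul_apply, Measure.add_apply, smul_eq_mul, measure_univ, mul_one]
    rw [add_tsub_cancel_of_le hν, ENNReal.inv_mul_cancel hn' (ENNReal.natCast_ne_top n)]
  · have h1 : Integrable g (((n : ENNReal) - ν univ) • Measure.dirac 0) :=
      (integrable_dirac (by simp)).smul_measure hd
    refine ⟨(hg.add_measure h1).smul_measure (ENNReal.inv_ne_top.2 hn'), ?_⟩
    rw [integral_smul_measure, integral_add_measure hg h1, integral_smul_measure, integral_dirac,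
      integral_sub hg (integrable_const _), integral_const, ENNReal.toReal_sub_of_le hν
      (ENNReal.natCast_ne_top n)]
    have hnC : (n : ℂ) ≠ 0 := Nat.cast_ne_zero.2 hn
    simp only [ENNReal.toReal_inv, ENNReal.toReal_natCast, real_smul, Measure.real]
    push_cast
    field_simp
    ring

/-- The law of the sum of the absolute values of `n` independent variables of law `ρ`. -/
theorem exists_laplaceTransform_eq_pow (ρ : Measure ℝ) [IsProbabilityMeasure ρ] (n : ℕ) :
    ∃ P : Measure ℝ, IsProbabilityMeasure P ∧ (∀ᵐ t ∂P, 0 ≤ t) ∧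
      ∀ z : ℂ, Integrable (fun t : ℝ => exp (-z * |t|)) ρ →
        Integrable (fun t : ℝ => exp (-z * t)) P ∧
        laplaceTransform P z = (∫ t : ℝ, exp (-z * |t|) ∂ρ) ^ n := by
  -- Absolute values make the sum nonnegative everywhere without a support condition on `ρ`.
  let X : (Fin n → ℝ) → ℝ := fun x => ∑ i, |x i|
  have hX : Measurable X := by fun_prop
  have hexp : ∀ (z : ℂ) (x : Fin n → ℝ), exp (-z * X x) = ∏ i, exp (-z * |x i|) := fun z x => by
    simp only [X]
    rw [← exp_sum]
    push_cast
    rw [Finset.mul_sum]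
  have hm : ∀ z : ℂ, AEStronglyMeasurable (fun t : ℝ => exp (-z * t))
      (Measure.map X (Measure.pi fun _ => ρ)) := fun z =>
    (by fun_prop : Continuous _).aestronglyMeasurable
  refine ⟨Measure.map X (Measure.pi fun _ => ρ), Measure.isProbabilityMeasure_map hX.aemeasurable,
    ?_, fun z hz => ⟨?_, ?_⟩⟩
  · rw [ae_map_iff hX.aemeasurable measurableSet_Ici]
    exact Eventually.of_forall fun x => Finset.sum_nonneg fun i _ => abs_nonneg _
  · rw [integrable_map_measure (hm z) hX.aemeasurable]
    simp only [Function.comp_def, hexp]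
    exact Integrable.fintype_prod fun _ => hz
  · rw [laplaceTransform, integral_map hX.aemeasurable (hm z)]
    simp only [hexp]
    rw [integral_fintype_prod_eq_pow (fun t : ℝ => exp (-z * |t|)), Fintype.card_fin]

section

variable {R : ℝ → ℝ} {C β : ℝ} (hR : Measurable R) (hR0 : ∀ t, 0 < t → 0 ≤ R t) (hC : 0 < C)
  (hβ : 0 < β) (hRle : ∀ t, 0 < t → R t ≤ C * Real.exp (-β * t))

include hR hR0 hC hβ hRle

omit hR hR0 in
theorem lintegral_div_le {ε : ℝ} (hε : 0 < ε) :
    ∫⁻ t in Ioi ε, ENNReal.ofReal (R t / t) ≤ ENNReal.ofReal (C / (β * ε)) := by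
  have h1 : IntegrableOn (fun t => C / ε * Real.exp (-β * t)) (Ioi 0) :=
    (exp_neg_integrableOn_Ioi 0 hβ).const_mul _
  calc ∫⁻ t in Ioi ε, ENNReal.ofReal (R t / t)
      ≤ ∫⁻ t in Ioi ε, ENNReal.ofReal (C / ε * Real.exp (-β * t)) := by
        refine setLIntegral_mono (by fun_prop) fun t ht => ENNReal.ofReal_le_ofReal ?_
        have ht' : ε < t := ht
        rw [div_mul_eq_mul_div]
        exact div_le_div₀ (by positivity) (hRle t (hε.trans ht')) hε ht'.le
    _ ≤ ∫⁻ t in Ioi 0, ENNReal.ofReal (C / ε * Real.exp (-β * t)) :=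
        lintegral_mono_set (Ioi_subset_Ioi hε.le)
    _ = ENNReal.ofReal (∫ t in Ioi 0, C / ε * Real.exp (-β * t)) :=
        (ofReal_integral_eq_lintegral_ofReal h1
          (Eventually.of_forall fun t => by positivity)).symm
    _ = ENNReal.ofReal (C / (β * ε)) := by
        rw [integral_const_mul, integral_exp_mul_Ioi (by linarith) 0]
        congr 1
        simp
        field_simp

omit hβ in
theorem integrableOn_exp_mul_div {ε : ℝ} (hε : 0 < ε) {z : ℂ} (hz : -β < z.re) :
    IntegrableOn (fun t : ℝ => exp (-z * t) * ((R t / t : ℝ) : ℂ)) (Ioi ε) := by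
  have h1 : IntegrableOn (fun t => C / ε * Real.exp (-(β + z.re) * t)) (Ioi ε) :=
    (exp_neg_integrableOn_Ioi ε (by linarith)).const_mul _
  refine Integrable.mono' h1 (by fun_prop) ?_
  filter_upwards [ae_restrict_mem measurableSet_Ioi] with t ht
  have ht' : ε < t := ht
  have ht0 := hε.trans ht'
  have h2 : R t / t ≤ C * Real.exp (-β * t) / ε :=
    div_le_div₀ (by positivity) (hRle t ht0) hε ht'.le
  rw [norm_mul, norm_exp, norm_real, Real.norm_of_nonneg (div_nonneg (hR0 t ht0) ht0.le)]
  calc Real.exp (-z * t).re * (R t / t)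
      ≤ Real.exp (-z * t).re * (C * Real.exp (-β * t) / ε) := by gcongr
    _ = C / ε * (Real.exp (-β * t) * Real.exp (-z * t).re) := by ring
    _ = C / ε * Real.exp (-(β + z.re) * t) := by
        rw [← Real.exp_add]
        congr 2
        simp
        ring

/-- One step of the approximation of an infinitely divisible law without drift. -/
theorem exists_laplaceTransform_eq {n : ℕ} (hn : n ≠ 0) :
    ∃ P : Measure ℝ, IsProbabilityMeasure P ∧ (∀ᵐ t ∂P, 0 ≤ t) ∧
      ∀ z : ℂ, -β < z.re → Integrable (fun t : ℝ => exp (-z * t)) P ∧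
        laplaceTransform P z = (1 + (n : ℂ)⁻¹ *
          ∫ t in Ioi (C / (β * n)), (exp (-z * t) - 1) * ((R t / t : ℝ) : ℂ)) ^ n := by
  have hn' : (0 : ℝ) < n := Nat.cast_pos.2 (Nat.pos_of_ne_zero hn)
  have hε : 0 < C / (β * n) := by positivity
  have hdm : Measurable fun t => ENNReal.ofReal (R t / t) := by fun_prop
  have hdt : ∀ᵐ t ∂volume.restrict (Ioi (C / (β * n))), ENNReal.ofReal (R t / t) < ⊤ :=
    Eventually.of_forall fun t => ENNReal.ofReal_lt_top
  set ν := (volume.restrict (Ioi (C / (β * n)))).withDensity fun t => ENNReal.ofReal (R t / t)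
    with hν
  -- The cutoff `ε = C / (β n)` is the one for which the mass bound `C / (β ε)` equals `n`.
  have hmass : ν univ ≤ n := by
    rw [hν, withDensity_apply _ MeasurableSet.univ, Measure.restrict_univ]
    refine (lintegral_div_le hC hβ hRle hε).trans_eq ?_
    rw [← ENNReal.ofReal_natCast]
    congr 1
    field_simp
  have htr : ∀ t ∈ Ioi (C / (β * n)), (ENNReal.ofReal (R t / t)).toReal = R t / t := fun t ht =>
    ENNReal.toReal_ofReal (div_nonneg (hR0 t (hε.trans ht)) (hε.trans ht).le)
  obtain ⟨ρ, hρ, hρg⟩ := exists_probabilityMeasure_of_mass_le ν hn hmass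
  obtain ⟨P, hP1, hP2, hP3⟩ := exists_laplaceTransform_eq_pow ρ n
  refine ⟨P, hP1, hP2, fun z hz => ?_⟩
  have hint : Integrable (fun t : ℝ => exp (-z * |t|)) ν := by
    rw [hν, integrable_withDensity_iff_integrable_smul' hdm hdt]
    refine (integrableOn_exp_mul_div hR hR0 hC hRle hε hz).congr_fun (fun t ht => ?_)
      measurableSet_Ioi
    simp only [htr t ht, abs_of_pos (hε.trans ht), real_smul, mul_comm]
  obtain ⟨h1, h2⟩ := hρg _ hint
  obtain ⟨h3, h4⟩ := hP3 z h1
  refine ⟨h3, ?_⟩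
  rw [h4, h2, abs_zero, ofReal_zero, mul_zero, exp_zero, hν,
    integral_withDensity_eq_integral_toReal_smul hdm hdt]
  congr 3
  refine setIntegral_congr_fun measurableSet_Ioi fun t ht => ?_
  simp only [htr t ht, abs_of_pos (hε.trans ht), real_smul, mul_comm]

/-- The Lévy–Khintchine construction of the law on the half-line with Lévy density `R t / t`. -/
theorem exists_tendsto_laplaceTransform
    (hint : ∀ z : ℂ, -β < z.re →
      IntegrableOn (fun t : ℝ => (exp (-z * t) - 1) * ((R t / t : ℝ) : ℂ)) (Ioi 0)) :
    ∃ P : ℕ → Measure ℝ, (∀ n, IsProbabilityMeasure (P n)) ∧ (∀ n, ∀ᵐ t ∂P n, 0 ≤ t) ∧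
      (∀ n (z : ℂ), -β < z.re → Integrable (fun t : ℝ => exp (-z * t)) (P n)) ∧
      ∀ z : ℂ, -β < z.re → Tendsto (fun n => laplaceTransform (P n) z) atTop
        (𝓝 (exp (∫ t in Ioi (0 : ℝ), (exp (-z * t) - 1) * ((R t / t : ℝ) : ℂ)))) := by
  choose P hP1 hP2 hP3 using fun n : ℕ =>
    exists_laplaceTransform_eq hR hR0 hC hβ hRle (n := n + 1) n.succ_ne_zero
  refine ⟨P, hP1, hP2, fun n z hz => (hP3 n z hz).1, fun z hz => ?_⟩
  simp only [fun n => (hP3 n z hz).2]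
  -- After undoing the shift `n + 1`, which avoided `n = 0`, the limit is `(1 + I_n / n)^n → e^I`,
  -- where the truncated integrals `I_n` converge to `I` as the cutoff tends to `0`.
  refine (tendsto_add_atTop_iff_nat (f := fun n : ℕ => (1 + (n : ℂ)⁻¹ *
    ∫ t in Ioi (C / (β * n)), (exp (-z * t) - 1) * ((R t / t : ℝ) : ℂ)) ^ n) 1).2 ?_
  refine tendsto_one_add_pow_exp_of_tendsto ?_
  refine (tendsto_add_atTop_iff_nat 1).1 ?_
  have hε : ∀ n : ℕ, 0 < C / (β * (n + 1 : ℕ)) := fun n => by positivity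
  have hanti : Antitone fun n : ℕ => C / (β * (n + 1 : ℕ)) := fun m n h => by
    dsimp only
    gcongr
  have hlim : Tendsto (fun n : ℕ => C / (β * (n + 1 : ℕ))) atTop (𝓝 0) :=
    Tendsto.const_div_atTop (((tendsto_natCast_atTop_atTop (R := ℝ)).comp
      (tendsto_add_atTop_nat 1)).const_mul_atTop hβ) C
  have hU : ⋃ n : ℕ, Ioi (C / (β * (n + 1 : ℕ))) = Ioi (0 : ℝ) := by
    ext t
    rw [mem_iUnion]
    exact ⟨fun ⟨n, hn⟩ => (hε n).trans hn, fun ht => (hlim.eventually_lt_const ht).exists⟩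
  have := tendsto_setIntegral_of_monotone
    (f := fun t : ℝ => (exp (-z * t) - 1) * ((R t / t : ℝ) : ℂ)) (μ := volume)
    (s := fun n : ℕ => Ioi (C / (β * (n + 1 : ℕ)))) (fun _ => measurableSet_Ioi)
    (fun m n h => Ioi_subset_Ioi (hanti h)) (by rw [hU]; exact hint z hz)
  rw [hU] at this
  refine this.congr fun n => ?_
  rw [mul_inv_cancel_left₀ (Nat.cast_ne_zero.2 n.succ_ne_zero)]

end

/-! ### Assembly of the main theorem. -/

/-- The Mellin transform of the Laplace transform series. -/
theorem integral_cpow_mul_laplaceSeries (M N : ℕ) (hMN : M + 1 ≤ N)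
    (a : Fin (M + 1) → ℝ) (ha : ∀ j, 0 < a j)
    (b : Fin (N + 1) → ℝ) (hb : ∀ j, 0 < b j) (i : Fin (M + 1)) :
    (∀ x : ℂ, Summable (laplaceTerm a b i x)) ∧
    ∀ q : ℂ, 0 < q.re → q.re < b 0 / a i →
      MeasureTheory.IntegrableOn
        (fun x : ℝ => (x : ℂ) ^ (q - 1) * laplaceSeries a b i (x : ℂ))
        (Set.Ioi 0) ∧
      ∫ x in Set.Ioi (0 : ℝ), (x : ℂ) ^ (q - 1) * laplaceSeries a b i (x : ℂ) =
        Complex.Gamma q * eta a b (-q * (a i : ℂ)) := by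
  obtain ⟨C, hC, hle⟩ := exists_levyRatio_le ha hb hMN
  have hR : Measurable (levyRatio a b) := by
    unfold levyRatio
    fun_prop
  have hle' : ∀ t, 0 < t → levyRatio a b t ≤ C * Real.exp (-b 0 * t) := fun t ht => by
    refine (hle t ht).trans (mul_le_of_le_one_right (by positivity) (pow_le_one₀ ?_ ?_))
    · simpa using ht.le
    · linarith [Real.exp_pos (-t)]
  -- The Mellin kernel at `s = 0` is `t^{-1}`, which turns the ratio into the Lévy density.
  have hmul : ∀ (z : ℂ) (t : ℝ), (t : ℂ) ^ ((0 : ℂ) - 1) •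
      ((exp (-z * t) - 1) * (levyRatio a b t : ℂ)) =
      (exp (-z * t) - 1) * ((levyRatio a b t / t : ℝ) : ℂ) := fun z t => by
    rw [zero_sub, cpow_neg_one, smul_eq_mul]
    push_cast
    ring
  have hlevy : ∀ z : ℂ, -b 0 < z.re →
      IntegrableOn (fun t : ℝ => (exp (-z * t) - 1) *
        ((levyRatio a b t / t : ℝ) : ℂ)) (Ioi 0) ∧
      eta a b z = exp (∫ t in Ioi (0 : ℝ), (exp (-z * t) - 1) *
        ((levyRatio a b t / t : ℝ) : ℂ)) := fun z hz => by
    have h := opS_logGamma_sub_eq ha hb hMN hz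
    simp only [MellinConvergent, mellin, hmul] at h
    exact ⟨h.1, by rw [eta, h.2]⟩
  obtain ⟨P, hP1, hP2, hP3, hP4⟩ := exists_tendsto_laplaceTransform hR
    (fun t ht => levyRatio_nonneg ha hb ht) hC (hb 0) hle' fun z hz => (hlevy z hz).1
  have hterm : ∀ (x : ℂ) (k : ℕ), laplaceTerm a b i x k =
      (-x) ^ k / (k.factorial : ℂ) * eta a b ((k : ℂ) * (a i : ℂ)) := fun x k => by
    rw [laplaceTerm, neg_sum_opS_logGamma_removeNth hMN ha hb,
      eta]
  have key := mellin_tsum_of_tendsto_laplaceTransform P hP2 (ha i) (hb 0)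
    (eta a b) hP3 fun z hz => by
      rw [(hlevy z hz).2]
      exact hP4 z hz
  simp only [laplaceSeries, hterm]
  exact ⟨fun x => (key.1 x).congr fun k => (hterm x k).symm, key.2⟩

end BarnesBeta

/-- Mellin transform of the Laplace transform series, with `M + 1 ≥ 1` parameters `a` and
`N ≥ M + 1`. The series converges everywhere, the Mellin integral converges absolutely. -/
theorem mainTheorem9 (M N : ℕ) (hMN : M + 1 ≤ N)
    (a : Fin (M + 1) → ℝ) (ha : ∀ j, 0 < a j)
    (b : Fin (N + 1) → ℝ) (hb : ∀ j, 0 < b j) (i : Fin (M + 1)) :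
    (∀ x : ℂ, Summable (BarnesBeta.laplaceTerm a b i x)) ∧
    ∀ q : ℂ, 0 < q.re → q.re < b 0 / a i →
      MeasureTheory.IntegrableOn
        (fun x : ℝ => (x : ℂ) ^ (q - 1) * BarnesBeta.laplaceSeries a b i (x : ℂ))
        (Set.Ioi 0) ∧
      ∫ x in Set.Ioi (0 : ℝ), (x : ℂ) ^ (q - 1) * BarnesBeta.laplaceSeries a b i (x : ℂ) =
        Complex.Gamma q * BarnesBeta.eta a b (-q * (a i : ℂ)) :=
  BarnesBeta.integral_cpow_mul_laplaceSeries M N hMN a ha b hb i
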